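/- Let $q$ be an indeterminate over $\mathbb C$ and let $n$ be a positive integer. Let $G_n(q)$ (the Hecke–Clifford algebra) be the associative unital algebra over the field $\mathbb C(q)$ of rational functions generated by elements $T_1,\dots,T_{n-1}$ and $C_1,\dots,C_n$ subject to the relations $$(T_k-q)(T_k+q^{-1})=0,\qquad T_kT_{k+1}T_k=T_{k+1}T_kT_{k+1},\qquad T_kT_l=T_lT_k\ \ (|k-l|\ge 2),$$ $$C_k^2=-1,\qquad C_kC_l=-C_lC_k\ \ (l\ne k),$$ $$T_kC_k=C_{k+1}T_k,\qquad T_kC_{k+1}=C_kT_k-(q-q^{-1})(C_k-C_{k+1}),\qquad T_kC_l=C_lT_k\ \ (l\ne k,k+1),$$ for all possible $k,l$. Then the algebra $G_n(q)$ is semisimple, that is, it is a direct sum of simple left ideals. -/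

import Mathlib

/-- The generators of the Hecke–Clifford algebra: `T k` for `k : Fin (n - 1)` and `C k` for
`k : Fin n`. Indices start at `0`, so `T k` and `C k` stand for the `(k+1)`-st generators. -/
inductive HeckeCliffordGen (n : ℕ) : Type
  | T (k : Fin (n - 1)) : HeckeCliffordGen n
  | C (k : Fin n) : HeckeCliffordGen n

namespace HeckeClifford

/-- The index `k`, as the index of a Clifford generator. -/
def lo {n : ℕ} (k : Fin (n - 1)) : Fin n := ⟨k.val, by omega⟩

/-- The index `k + 1`, as the index of a Clifford generator. -/
def hi {n : ℕ} (k : Fin (n - 1)) : Fin n := ⟨k.val + 1, by omega⟩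

/-- The generator `T_k` in the free algebra. -/
def freeT (R : Type*) [CommRing R] {n : ℕ} (k : Fin (n - 1)) :
    FreeAlgebra R (HeckeCliffordGen n) :=
  FreeAlgebra.ι R (HeckeCliffordGen.T k)

/-- The generator `C_k` in the free algebra. -/
def freeC (R : Type*) [CommRing R] {n : ℕ} (k : Fin n) :
    FreeAlgebra R (HeckeCliffordGen n) :=
  FreeAlgebra.ι R (HeckeCliffordGen.C k)

/-- The defining relations of the Hecke–Clifford algebra, for an invertible parameter `q`. -/
inductive Rel (R : Type*) [CommRing R] (q : Rˣ) (n : ℕ) :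
    FreeAlgebra R (HeckeCliffordGen n) → FreeAlgebra R (HeckeCliffordGen n) → Prop
  /-- `(T_k - q) (T_k + q⁻¹) = 0` -/
  | quadratic (k : Fin (n - 1)) :
      Rel R q n
        ((freeT R k - algebraMap R _ (q : R)) * (freeT R k + algebraMap R _ ((q⁻¹ : Rˣ) : R))) 0
  /-- `T_k T_{k+1} T_k = T_{k+1} T_k T_{k+1}` -/
  | braid (k l : Fin (n - 1)) (h : l.val = k.val + 1) :
      Rel R q n (freeT R k * freeT R l * freeT R k) (freeT R l * freeT R k * freeT R l)
  /-- `T_k T_l = T_l T_k` for non-adjacent `k`, `l` -/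
  | comm (k l : Fin (n - 1)) (h : k.val + 1 < l.val ∨ l.val + 1 < k.val) :
      Rel R q n (freeT R k * freeT R l) (freeT R l * freeT R k)
  /-- `C_k ^ 2 = -1` -/
  | square (k : Fin n) :
      Rel R q n (freeC R k ^ 2) (-1)
  /-- `C_k C_l = - C_l C_k` for `l ≠ k` -/
  | anticomm (k l : Fin n) (h : l ≠ k) :
      Rel R q n (freeC R k * freeC R l) (-(freeC R l * freeC R k))
  /-- `T_k C_k = C_{k+1} T_k` -/
  | crossLo (k : Fin (n - 1)) :
      Rel R q n (freeT R k * freeC R (lo k)) (freeC R (hi k) * freeT R k)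
  /-- `T_k C_{k+1} = C_k T_k - (q - q⁻¹) (C_k - C_{k+1})` -/
  | crossHi (k : Fin (n - 1)) :
      Rel R q n (freeT R k * freeC R (hi k))
        (freeC R (lo k) * freeT R k -
          ((q : R) - ((q⁻¹ : Rˣ) : R)) • (freeC R (lo k) - freeC R (hi k)))
  /-- `T_k C_l = C_l T_k` for `l ≠ k, k + 1` -/
  | crossComm (k : Fin (n - 1)) (l : Fin n) (h₁ : l ≠ lo k) (h₂ : l ≠ hi k) :
      Rel R q n (freeT R k * freeC R l) (freeC R l * freeT R k)

end HeckeClifford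

/-- The Hecke–Clifford algebra over a commutative ring `R` with invertible parameter `q`:
the associative unital `R`-algebra presented by the generators `T_k`, `C_k` and the
relations `HeckeClifford.Rel`. -/
abbrev HeckeCliffordAlgebra (R : Type*) [CommRing R] (q : Rˣ) (n : ℕ) : Type _ :=
  RingQuot (HeckeClifford.Rel R q n)

/-- The indeterminate `q` of the field `ℂ(q)` of rational functions, as a unit. -/
noncomputable def qUnit : (RatFunc ℂ)ˣ := Units.mk0 RatFunc.X RatFunc.X_ne_zero

/-!
The algebra is semisimple because it is a quotient, as a left module over itself, of a module that
carries an invariant positive definite Hermitian form.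

Write `K = ℂ(q)`, `e = q - q⁻¹`, and let `σ` be complex conjugation of the coefficients of a
rational function. It fixes `q`, and `∑ σ(xᵢ) xᵢ = 0` forces every `xᵢ` to vanish
(`eq_zero_of_sum_ratFuncConj_mul_self`), by evaluation at real arguments.

The module is modelled on the expected basis `C^ε T_w`. To avoid keeping track of signs, the
monomials `C^ε` are replaced by the finite group `CliffordGroup n` with generators `c k` and a
central element `zeta` in the role of `-1`, and the module is the space `OddFun n K` of functions
`f` on `CliffordGroup n × Perm (Fin n)` with `f (zeta * g, u) = -f (g, u)`. On it `C k` acts by left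
translation and `T k` by the formula that the cross relations dictate. With
`a = c (lo k)`, `b = c (hi k)` and the adjacent transposition `s`, it reads
`T k · g = s(g) · T k + (e / 2) ((1 + ab) g - s(g) (1 + ab))`.

For the form `∑ σ(f) h` the adjoint of `C k` is `-C k` and the adjoint of `T k` is
`T k - e C (lo k) C (hi k)` (`isAdj_cOp`, `isAdj_tOp`). So the acting algebra is closed under
adjoints, orthogonal complements of submodules are submodules, and the module is semisimple
(`isSemisimpleModule_of_anisotropic`).

The cross relations are checked pointwise. The relations among the `T k` are reduced to the Hecke
algebra: the difference `X` of the two sides of such a relation satisfies `X C_k = C_l X`, so its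
adjoint commutes past the `C_k` in the same way, and vanishes as soon as it vanishes at the points
`(1, u)`, where the adjoint of `T k` acts by the regular representation of the Hecke algebra
(`IsAdj.eq_zero_of_apply_one`).

Finally, `f ↦ ∑ f(g, u) g T_u`, with `T_u` a product along a reduced word of `u`
(`reducedProd`, independent of the word by `reducedProd_eq_mul`), is linear over the algebra
(`toAlg_action`) and takes the invertible value `2`. It is therefore surjective, and no linear
independence of the elements `C^ε T_w` is needed.
-/

/-! ### Semisimplicity from an anisotropic form -/

/-- A finite-dimensional module with an anisotropic sesquilinear form, over an algebra generated by
elements that have adjoints in it, is semisimple: orthogonal complements are submodules, and a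
dimension count makes them complements. -/
theorem isSemisimpleModule_of_anisotropic {K A V : Type*} [Field K] [Ring A] [Algebra K A]
    [AddCommGroup V] [Module K V] [Module A V] [IsScalarTower K A V] [FiniteDimensional K V]
    {σ : K →+* K} (B : V →ₛₗ[σ] V →ₗ[K] K) (hB : ∀ v, B v v = 0 → v = 0)
    {s : Set A} (hs : Algebra.adjoin K s = ⊤)
    (hadj : ∀ x ∈ s, ∃ y : A, ∀ v w, B (y • v) w = B v (x • w)) :
    IsSemisimpleModule A V := by
  refine (isSemisimpleModule_iff A V).2 ⟨fun W => ?_⟩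
  have hstab : ∀ x : A, ∀ w, (∀ v ∈ W, B v w = 0) → ∀ v ∈ W, B v (x • w) = 0 := by
    intro x
    have hx : x ∈ Algebra.adjoin K s := by rw [hs]; trivial
    induction hx using Algebra.adjoin_induction with
    | mem x hx =>
      obtain ⟨y, hy⟩ := hadj x hx
      intro w hw v hv
      rw [← hy]
      exact hw _ (W.smul_mem y hv)
    | algebraMap c =>
      intro w hw v hv
      rw [algebraMap_smul, map_smul, hw v hv, smul_zero]
    | add x y _ _ hx hy =>
      intro w hw v hv
      rw [add_smul, map_add, hx w hw v hv, hy w hw v hv, add_zero]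
    | mul x y _ _ hx hy =>
      intro w hw v hv
      rw [mul_smul]
      exact hx _ (hy w hw) v hv
  let W' : Submodule A V :=
    { carrier := {w | ∀ v ∈ W, B v w = 0}
      add_mem' := fun {a b} ha hb v hv => by rw [map_add, ha v hv, hb v hv, add_zero]
      zero_mem' := fun v _ => map_zero _
      smul_mem' := fun x w hw => hstab x w hw }
  have hdis : Disjoint W W' := by
    rw [Submodule.disjoint_def]
    exact fun v hv hv' => hB v (hv' v hv)
  let U : Submodule K V := W.restrictScalars K
  let U' : Submodule K V := W'.restrictScalars K
  have hdisK : Disjoint U U' := by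
    rw [Submodule.disjoint_def]
    exact fun v hv hv' => hB v (hv' v hv)
  -- The complement contains the kernel of `dim W` linear functionals, so it has codimension at most
  -- `dim W`.
  let b := Module.finBasis K U
  let L : V →ₗ[K] (Fin (Module.finrank K U) → K) := LinearMap.pi fun i => B (b i : V)
  have hker : LinearMap.ker L ≤ U' := by
    intro w hw v hv
    have hw' : ∀ i, B (b i : V) w = 0 := fun i => congrFun (LinearMap.mem_ker.1 hw) i
    have hsum : ∑ i, b.repr ⟨v, hv⟩ i • (b i : V) = v := by
      have h := congrArg U.subtype (b.sum_repr ⟨v, hv⟩)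
      rw [map_sum] at h
      exact h
    rw [← hsum]
    simp [hw']
  have hdim : Module.finrank K V ≤ Module.finrank K U + Module.finrank K U' := by
    have h1 := L.finrank_range_add_finrank_ker
    have h2 := Submodule.finrank_le (LinearMap.range L)
    have h3 := Submodule.finrank_mono hker
    rw [Module.finrank_fin_fun] at h2
    omega
  have hc := (Submodule.isCompl_iff_disjoint U U' hdim).2 hdisK
  refine ⟨W', hdis, ?_⟩
  rw [codisjoint_iff, Submodule.eq_top_iff']
  intro v
  have hv : v ∈ U ⊔ U' := by rw [hc.sup_eq_top]; trivial
  obtain ⟨x, hx, y, hy, rfl⟩ := Submodule.mem_sup.1 hv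
  exact Submodule.add_mem_sup (S := W) (T := W') hx hy

/-! ### Conjugation of rational functions -/

open Polynomial in
/-- At a real argument `t` the sum is `∑ |p i (t)|²`, so every real number is a root of each `p i`. -/
theorem Polynomial.eq_zero_of_sum_conj_mul_self {ι : Type*} (s : Finset ι) (p : ι → ℂ[X])
    (h : ∑ i ∈ s, (p i).map (starRingEnd ℂ) * p i = 0) : ∀ i ∈ s, p i = 0 := by
  intro i hi
  have hroot : ∀ t : ℝ, (p i).eval (t : ℂ) = 0 := by
    intro t
    have h0 := congrArg (Polynomial.eval (t : ℂ)) h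
    have hconj : ∀ j, ((p j).map (starRingEnd ℂ)).eval (t : ℂ)
        = starRingEnd ℂ ((p j).eval (t : ℂ)) := fun j => by
      conv_lhs => rw [← Complex.conj_ofReal t]
      rw [Polynomial.eval_map, Polynomial.eval₂_at_apply]
    simp only [Polynomial.eval_finsetSum, Polynomial.eval_mul, hconj, Polynomial.eval_zero,
      ← Complex.normSq_eq_conj_mul_self] at h0
    have h1 : ∑ j ∈ s, Complex.normSq ((p j).eval (t : ℂ)) = 0 := by exact_mod_cast h0
    exact Complex.normSq_eq_zero.1
      ((Finset.sum_eq_zero_iff_of_nonneg fun j _ => Complex.normSq_nonneg _).1 h1 i hi)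
  refine Polynomial.eq_zero_of_infinite_isRoot _ ?_
  exact (Set.infinite_range_of_injective Complex.ofReal_injective).mono
    (by rintro _ ⟨t, rfl⟩; exact hroot t)

/-- The field endomorphism of `ℂ(q)` that conjugates coefficients and fixes `q`. -/
noncomputable def ratFuncConj : RatFunc ℂ →+* RatFunc ℂ :=
  RatFunc.mapRingHom (Polynomial.mapRingHom (starRingEnd ℂ))
    (nonZeroDivisors_le_comap_nonZeroDivisors_of_injective _
      (Polynomial.map_injective _ (starRingEnd ℂ).injective))

theorem ratFuncConj_algebraMap (p : Polynomial ℂ) :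
    ratFuncConj (algebraMap _ _ p) = algebraMap _ _ (p.map (starRingEnd ℂ)) := by
  have h := RatFunc.map_apply_div (φ := Polynomial.mapRingHom (starRingEnd ℂ))
    (nonZeroDivisors_le_comap_nonZeroDivisors_of_injective _
      (Polynomial.map_injective _ (starRingEnd ℂ).injective)) p 1
  simpa [ratFuncConj, RatFunc.coe_mapRingHom_eq_coe_map] using h

theorem ratFuncConj_X : ratFuncConj RatFunc.X = RatFunc.X := by
  rw [← RatFunc.algebraMap_X, ratFuncConj_algebraMap, Polynomial.map_X]

theorem eq_zero_of_sum_ratFuncConj_mul_self {ι : Type*} (s : Finset ι) (x : ι → RatFunc ℂ)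
    (h : ∑ i ∈ s, ratFuncConj (x i) * x i = 0) : ∀ i ∈ s, x i = 0 := by
  classical
  -- A common denominator `d` reduces the claim to polynomials.
  obtain ⟨⟨d, hd⟩, hdx⟩ := IsLocalization.exist_integer_multiples
    (nonZeroDivisors (Polynomial ℂ)) s x
  choose! p hp using hdx
  have hd0 : d ≠ 0 := nonZeroDivisors.ne_zero hd
  have hp' : ∀ i ∈ s, algebraMap _ (RatFunc ℂ) (p i) = algebraMap _ _ d * x i := fun i hi => by
    rw [hp i hi, Algebra.smul_def]
  have hzero : ∑ i ∈ s, (p i).map (starRingEnd ℂ) * p i = 0 := by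
    apply RatFunc.algebraMap_injective ℂ
    rw [map_sum, map_zero]
    calc _ = ∑ i ∈ s, (ratFuncConj (algebraMap _ _ d) * algebraMap _ _ d) *
          (ratFuncConj (x i) * x i) := by
            refine Finset.sum_congr rfl fun i hi => ?_
            rw [map_mul, ← ratFuncConj_algebraMap, hp' i hi, map_mul]
            ring
      _ = 0 := by rw [← Finset.mul_sum, h, mul_zero]
  intro i hi
  have hi0 := hp' i hi
  rw [Polynomial.eq_zero_of_sum_conj_mul_self s p hzero i hi, map_zero] at hi0
  exact (mul_eq_zero.1 hi0.symm).resolve_left (by simpa using hd0)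

namespace HeckeClifford

open Equiv

variable {n : ℕ}

/-! ### Adjacent transpositions and products along reduced words -/

/-- The transposition of the positions `k` and `k + 1`. -/
def adjSwap (k : Fin (n - 1)) : Perm (Fin n) := swap (lo k) (hi k)

theorem lo_lt_hi (k : Fin (n - 1)) : lo k < hi k := by simp [lo, hi, Fin.lt_def]

theorem lo_ne_hi (k : Fin (n - 1)) : lo k ≠ hi k := (lo_lt_hi k).ne

@[simp] theorem adjSwap_lo (k : Fin (n - 1)) : adjSwap k (lo k) = hi k := swap_apply_left _ _
@[simp] theorem adjSwap_hi (k : Fin (n - 1)) : adjSwap k (hi k) = lo k := swap_apply_right _ _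

theorem adjSwap_of_ne {k : Fin (n - 1)} {l : Fin n} (h₁ : l ≠ lo k) (h₂ : l ≠ hi k) :
    adjSwap k l = l := swap_apply_of_ne_of_ne h₁ h₂

@[simp] theorem adjSwap_adjSwap (k : Fin (n - 1)) (l : Fin n) :
    adjSwap k (adjSwap k l) = l := swap_apply_self _ _ _

@[simp] theorem mul_adjSwap_mul_adjSwap (u : Perm (Fin n)) (k : Fin (n - 1)) :
    u * adjSwap k * adjSwap k = u := by
  rw [mul_assoc, adjSwap, swap_mul_self, mul_one]

section adjacent
variable {k l : Fin (n - 1)}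

theorem adjSwap_hi_of_adjacent (h : l.val = k.val + 1) : adjSwap k (hi l) = hi l :=
  adjSwap_of_ne (by simp only [lo, hi, ne_eq, Fin.ext_iff]; omega)
    (by simp only [hi, ne_eq, Fin.ext_iff]; omega)

theorem adjSwap_lo_of_adjacent (h : l.val = k.val + 1) : adjSwap l (lo k) = lo k :=
  adjSwap_of_ne (by simp only [lo, ne_eq, Fin.ext_iff]; omega)
    (by simp only [lo, hi, ne_eq, Fin.ext_iff]; omega)

theorem adjSwap_braid (h : l.val = k.val + 1) :
    adjSwap k * adjSwap l * adjSwap k = adjSwap l * adjSwap k * adjSwap l := by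
  have hlk : lo l = hi k := Fin.ext h
  have h1 : (adjSwap k * adjSwap l) (lo k) = lo l := by
    rw [Perm.mul_apply, adjSwap_lo_of_adjacent h, adjSwap_lo, hlk]
  have h2 : (adjSwap k * adjSwap l) (hi k) = hi l := by
    rw [Perm.mul_apply, ← hlk, adjSwap_lo, adjSwap_hi_of_adjacent h]
  have h3 := mul_swap_eq_swap_mul (adjSwap k * adjSwap l) (lo k) (hi k)
  rw [h1, h2] at h3
  exact h3.trans (mul_assoc _ _ _).symm

end adjacent

section far
variable {k l : Fin (n - 1)}

theorem adjSwap_lo_of_far (h : k.val + 1 < l.val ∨ l.val + 1 < k.val) : adjSwap k (lo l) = lo l :=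
  adjSwap_of_ne (by simp only [lo, ne_eq, Fin.ext_iff]; omega)
    (by simp only [lo, hi, ne_eq, Fin.ext_iff]; omega)

theorem adjSwap_hi_of_far (h : k.val + 1 < l.val ∨ l.val + 1 < k.val) : adjSwap k (hi l) = hi l :=
  adjSwap_of_ne (by simp only [lo, hi, ne_eq, Fin.ext_iff]; omega)
    (by simp only [hi, ne_eq, Fin.ext_iff]; omega)

theorem adjSwap_comm (h : k.val + 1 < l.val ∨ l.val + 1 < k.val) :
    adjSwap k * adjSwap l = adjSwap l * adjSwap k := by
  conv_lhs =>
    rw [adjSwap.eq_def l, mul_swap_eq_swap_mul, adjSwap_lo_of_far h, adjSwap_hi_of_far h]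
  rfl

end far

/-- Swapping two adjacent values in descending order makes a permutation, read as the word of its
values, lexicographically smaller. This is the measure behind `reducedProd`. -/
theorem toLex_mul_adjSwap_lt {u : Perm (Fin n)} {k : Fin (n - 1)} (h : u (hi k) < u (lo k)) :
    toLex (⇑(u * adjSwap k)) < toLex (⇑u) := by
  refine ⟨lo k, fun j hj => ?_, by simpa using h⟩
  have : adjSwap k j = j := adjSwap_of_ne hj.ne (hj.trans (lo_lt_hi k)).ne
  simp [this]

section
variable {M : Type*} [Monoid M]

instance : WellFoundedRelation (Lex (Fin n → Fin n)) := WellFoundedLT.toWellFoundedRelation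

open Classical in
/-- The product of the `t k` along a reduced word of `u`, found by removing an arbitrary descent at
each step. The letters are read so that `u = s_m ⋯ s_1` gives `t 1 ⋯ t m`: this is the usual
`T_w` for `w = u⁻¹`. -/
noncomputable def reducedProd (t : Fin (n - 1) → M) (u : Perm (Fin n)) : M :=
  if h : ∃ k, u (hi k) < u (lo k) then t h.choose * reducedProd t (u * adjSwap h.choose) else 1
termination_by toLex (⇑u)
decreasing_by exact toLex_mul_adjSwap_lt h.choose_spec

theorem reducedProd_one (t : Fin (n - 1) → M) : reducedProd t 1 = 1 := by
  rw [reducedProd, dif_neg]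
  rintro ⟨k, hk⟩
  exact (lo_lt_hi k).asymm hk

/-- Any descent may be removed first. Two descents `k`, `l` of `u` are compared by removing both, or
all three of the alternating word when they are adjacent, and using the braid or commutation
relation. -/
theorem reducedProd_eq_mul {t : Fin (n - 1) → M}
    (hbraid : ∀ k l : Fin (n - 1), l.val = k.val + 1 → t k * t l * t k = t l * t k * t l)
    (hcomm : ∀ k l : Fin (n - 1), k.val + 1 < l.val ∨ l.val + 1 < k.val →
      t k * t l = t l * t k) (u : Perm (Fin n)) (k : Fin (n - 1)) (hk : u (hi k) < u (lo k)) :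
    reducedProd t u = t k * reducedProd t (u * adjSwap k) := by
  suffices H : ∀ x : Lex (Fin n → Fin n), ∀ u : Perm (Fin n), toLex ⇑u = x →
      ∀ k, u (hi k) < u (lo k) → reducedProd t u = t k * reducedProd t (u * adjSwap k) from
    H _ u rfl k hk
  clear hk k u
  intro x
  induction x using WellFoundedLT.induction with
  | ind x ih =>
  rintro u rfl k hk
  have ih' : ∀ v : Perm (Fin n), toLex ⇑v < toLex ⇑u → ∀ k, v (hi k) < v (lo k) →
      reducedProd t v = t k * reducedProd t (v * adjSwap k) := fun v hv => ih _ hv v rfl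
  have hadj : ∀ k l : Fin (n - 1), u (hi k) < u (lo k) → u (hi l) < u (lo l) →
      l.val = k.val + 1 →
      t k * reducedProd t (u * adjSwap k) = t l * reducedProd t (u * adjSwap l) := by
    intro k l hk hl h
    have hlk : lo l = hi k := Fin.ext h
    have hk_hl := adjSwap_hi_of_adjacent h
    have hl_lk := adjSwap_lo_of_adjacent h
    have hk_ll : adjSwap k (lo l) = lo k := by rw [hlk, adjSwap_hi]
    have hl_hk : adjSwap l (hi k) = hi l := by rw [← hlk, adjSwap_lo]
    have ak := toLex_mul_adjSwap_lt hk
    have al := toLex_mul_adjSwap_lt hl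
    have hkl : (u * adjSwap k) (hi l) < (u * adjSwap k) (lo l) := by
      simp only [Perm.mul_apply, hk_hl, hk_ll]; rw [hlk] at hl; exact hl.trans hk
    have hlk' : (u * adjSwap l) (hi k) < (u * adjSwap l) (lo k) := by
      simp only [Perm.mul_apply, hl_hk, hl_lk]; rw [hlk] at hl; exact hl.trans hk
    have akl := (toLex_mul_adjSwap_lt hkl).trans ak
    have alk := (toLex_mul_adjSwap_lt hlk').trans al
    have hklk : (u * adjSwap k * adjSwap l) (hi k) < (u * adjSwap k * adjSwap l) (lo k) := by
      simp only [Perm.mul_apply, hl_hk, hl_lk, hk_hl, adjSwap_lo]; rwa [hlk] at hl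
    have hlkl : (u * adjSwap l * adjSwap k) (hi l) < (u * adjSwap l * adjSwap k) (lo l) := by
      simp only [Perm.mul_apply, hk_hl, adjSwap_hi, hl_lk, hlk]; exact hk
    rw [ih' _ ak l hkl, ih' _ akl k hklk, ih' _ al k hlk', ih' _ alk l hlkl]
    have e : u * adjSwap k * adjSwap l * adjSwap k = u * adjSwap l * adjSwap k * adjSwap l := by
      have := adjSwap_braid h
      simp only [mul_assoc] at this ⊢
      rw [this]
    rw [e]
    simp only [← mul_assoc]
    rw [hbraid k l h]
  have hfar : ∀ k l : Fin (n - 1), u (hi k) < u (lo k) → u (hi l) < u (lo l) →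
      k.val + 1 < l.val ∨ l.val + 1 < k.val →
      t k * reducedProd t (u * adjSwap k) = t l * reducedProd t (u * adjSwap l) := by
    intro k l hk hl h
    have hkl : (u * adjSwap k) (hi l) < (u * adjSwap k) (lo l) := by
      rwa [Perm.mul_apply, Perm.mul_apply, adjSwap_lo_of_far h, adjSwap_hi_of_far h]
    have hlk : (u * adjSwap l) (hi k) < (u * adjSwap l) (lo k) := by
      rwa [Perm.mul_apply, Perm.mul_apply, adjSwap_lo_of_far h.symm, adjSwap_hi_of_far h.symm]
    rw [ih' _ (toLex_mul_adjSwap_lt hk) l hkl, ih' _ (toLex_mul_adjSwap_lt hl) k hlk,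
      ← mul_assoc, ← mul_assoc, hcomm k l h, mul_assoc u, mul_assoc u, adjSwap_comm h]
  have hex : ∃ k, u (hi k) < u (lo k) := ⟨k, hk⟩
  rw [reducedProd, dif_pos hex]
  have hl := hex.choose_spec
  generalize hex.choose = l at hl ⊢
  rcases lt_trichotomy k.val l.val with hlt | heq | hgt
  · rcases eq_or_ne l.val (k.val + 1) with h | h
    · exact (hadj k l hk hl h).symm
    · exact hfar l k hl hk (Or.inr (by omega))
  · rw [Fin.ext heq]
  · rcases eq_or_ne k.val (l.val + 1) with h | h
    · exact hadj l k hl hk h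
    · exact hfar l k hl hk (Or.inl (by omega))
end

/-! ### The Clifford group -/

/-- The relations `ζ² = 1`, `c_k² = ζ` and `c_k c_l = ζ c_l c_k` for `k ≠ l`, with `none` standing for
`ζ` and `some k` for `c_k`. Centrality of `ζ` follows, as `ζ = c_k²` for every `k`. -/
def cliffordRelators (n : ℕ) : Set (FreeGroup (Option (Fin n))) :=
  {w | w = FreeGroup.of none * FreeGroup.of none ∨
    (∃ k : Fin n, w = FreeGroup.of (some k) * FreeGroup.of (some k) * (FreeGroup.of none)⁻¹) ∨
    ∃ k l : Fin n, k ≠ l ∧ w = FreeGroup.of (some k) * FreeGroup.of (some l) *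
      (FreeGroup.of none * (FreeGroup.of (some l) * FreeGroup.of (some k)))⁻¹}

/-- The group of signed Clifford monomials, with a central element `ζ` in place of `-1`. -/
abbrev CliffordGroup (n : ℕ) : Type := PresentedGroup (cliffordRelators n)

namespace CliffordGroup


/-- The central element that stands for `-1`. -/
def zeta : CliffordGroup n := PresentedGroup.of none

/-- The generator that stands for the Clifford generator `C_k`. -/
def c (k : Fin n) : CliffordGroup n := PresentedGroup.of (some k)

theorem zeta_mul_zeta : (zeta : CliffordGroup n) * zeta = 1 :=
  (PresentedGroup.one_of_mem (rels := cliffordRelators n) (Or.inl rfl))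

theorem c_mul_self (k : Fin n) : c k * c k = zeta :=
  mul_inv_eq_one.1
    (PresentedGroup.one_of_mem (rels := cliffordRelators n) (Or.inr (Or.inl ⟨k, rfl⟩)))

theorem c_mul_c {k l : Fin n} (h : k ≠ l) : c k * c l = zeta * (c l * c k) :=
  mul_inv_eq_one.1
    (PresentedGroup.one_of_mem (rels := cliffordRelators n) (Or.inr (Or.inr ⟨k, l, h, rfl⟩)))

theorem zeta_mul_c (k : Fin n) : zeta * c k = c k * zeta := by
  rw [← c_mul_self k, mul_assoc]

theorem zeta_inv : (zeta : CliffordGroup n)⁻¹ = zeta :=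
  inv_eq_of_mul_eq_one_left zeta_mul_zeta

theorem c_inv (k : Fin n) : (c k)⁻¹ = zeta * c k :=
  inv_eq_of_mul_eq_one_left (by rw [mul_assoc, c_mul_self, zeta_mul_zeta])

@[elab_as_elim]
theorem induction_left {p : CliffordGroup n → Prop} (g : CliffordGroup n) (one : p 1)
    (zeta_mul : ∀ g, p g → p (zeta * g)) (c_mul : ∀ k g, p g → p (c k * g)) : p g := by
  have hg : g ∈ Subgroup.closure (Set.range (PresentedGroup.of (rels := cliffordRelators n))) := by
    rw [PresentedGroup.closure_range_of]; trivial
  induction hg using Subgroup.closure_induction_left with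
  | one => exact one
  | mul_left x hx y _ hy =>
    obtain ⟨_ | k, rfl⟩ := hx
    · exact zeta_mul _ hy
    · exact c_mul k _ hy
  | inv_mul_cancel x hx y _ hy =>
    obtain ⟨_ | k, rfl⟩ := hx
    · change p (zeta⁻¹ * y)
      rw [zeta_inv]
      exact zeta_mul _ hy
    · change p ((c k)⁻¹ * y)
      rw [c_inv, mul_assoc]
      exact zeta_mul _ (c_mul k _ hy)

instance : Finite (CliffordGroup n) := by
  -- A finite set that is stable under left multiplication by `ζ` and the `c_j` with `j ∈ s`; adding
  -- the index `k` to `s` turns `F` into `F ∪ c_k F`.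
  have key : ∀ s : Finset (Fin n), ∃ F : Set (CliffordGroup n), F.Finite ∧ 1 ∈ F ∧
      ∀ g ∈ F, zeta * g ∈ F ∧ ∀ j ∈ s, c j * g ∈ F := by
    intro s
    induction s using Finset.induction_on with
    | empty =>
      refine ⟨{1, zeta}, by simp, by simp, ?_⟩
      rintro g (rfl | rfl) <;> simp [zeta_mul_zeta]
    | insert k s hk ih =>
      obtain ⟨F, hF, h1, hmul⟩ := ih
      refine ⟨F ∪ (fun g => c k * g) '' F, hF.union (hF.image _), Or.inl h1, ?_⟩
      rintro g (hg | ⟨g, hg, rfl⟩)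
      · refine ⟨Or.inl (hmul g hg).1, fun j hj => ?_⟩
        rcases Finset.mem_insert.1 hj with rfl | hj
        · exact Or.inr ⟨g, hg, rfl⟩
        · exact Or.inl ((hmul g hg).2 j hj)
      · refine ⟨Or.inr ⟨zeta * g, (hmul g hg).1, ?_⟩, fun j hj => ?_⟩
        · simp only [← mul_assoc, zeta_mul_c]
        · rcases Finset.mem_insert.1 hj with rfl | hj'
          · refine Or.inl ?_
            simp only [← mul_assoc, c_mul_self]
            exact (hmul g hg).1
          · have hne : j ≠ k := fun h => hk (h ▸ hj')
            refine Or.inr ⟨zeta * (c j * g), (hmul _ ((hmul g hg).2 j hj')).1, ?_⟩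
            change c k * (zeta * (c j * g)) = c j * (c k * g)
            rw [← mul_assoc (c j), c_mul_c hne, ← mul_assoc (c k), ← zeta_mul_c]
            simp only [mul_assoc]
  obtain ⟨F, hF, h1, hmul⟩ := key Finset.univ
  have : F = Set.univ := by
    ext g
    simp only [Set.mem_univ, iff_true]
    induction g using induction_left with
    | one => exact h1
    | zeta_mul g h => exact (hmul g h).1
    | c_mul k g h => exact (hmul g h).2 k (Finset.mem_univ k)
  exact Set.finite_univ_iff.1 (this ▸ hF)

noncomputable instance : Fintype (CliffordGroup n) := Fintype.ofFinite _

/-- The action of permutations of the indices. -/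
def permHom (π : Perm (Fin n)) : CliffordGroup n →* CliffordGroup n :=
  PresentedGroup.toGroup (f := fun x => PresentedGroup.of (x.map π)) (by
    rintro w (rfl | ⟨k, rfl⟩ | ⟨k, l, h, rfl⟩) <;>
      simp only [map_mul, FreeGroup.lift_apply_of, map_inv, mul_inv_eq_one]
    · exact zeta_mul_zeta
    · exact c_mul_self (π k)
    · exact c_mul_c (π.injective.ne h))

@[simp] theorem permHom_zeta (π : Perm (Fin n)) : permHom π zeta = zeta :=
  PresentedGroup.toGroup.of _

@[simp] theorem permHom_c (π : Perm (Fin n)) (k : Fin n) : permHom π (c k) = c (π k) :=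
  PresentedGroup.toGroup.of _

theorem permHom_permHom_of_mul_self {π : Perm (Fin n)} (h : ∀ k, π (π k) = k)
    (g : CliffordGroup n) : permHom π (permHom π g) = g := by
  induction g using induction_left with
  | one => simp
  | zeta_mul g hg => simp [hg]
  | c_mul k g hg => simp [hg, h]

/-- Elements of a ring that satisfy the Clifford relations define a representation of the Clifford
group in which `ζ` acts as `-1`. -/
def toUnits {R : Type*} [Ring R] (x : Fin n → R) (hsq : ∀ k, x k * x k = -1)
    (hanti : ∀ k l, k ≠ l → x k * x l = -(x l * x k)) : CliffordGroup n →* Rˣ :=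
  let f : Option (Fin n) → Rˣ := fun o =>
    o.elim (-1) fun k => ⟨x k, -x k, by simp [hsq], by simp [hsq]⟩
  PresentedGroup.toGroup (f := f) (by
    rintro w (rfl | ⟨k, rfl⟩ | ⟨k, l, h, rfl⟩)
    · simp [f]
    · simp only [map_mul, FreeGroup.lift_apply_of, map_inv, mul_inv_eq_one]
      ext
      simp [f, hsq]
    · simp only [map_mul, FreeGroup.lift_apply_of, map_inv, mul_inv_eq_one]
      ext
      simp [f, hanti k l h])

section toUnits
variable {R : Type*} [Ring R] (x : Fin n → R) (hsq : ∀ k, x k * x k = -1)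
    (hanti : ∀ k l, k ≠ l → x k * x l = -(x l * x k))

theorem toUnits_zeta : (toUnits x hsq hanti zeta : R) = -1 := by
  unfold toUnits zeta
  rw [PresentedGroup.toGroup.of]; simp

theorem toUnits_c (k : Fin n) : (toUnits x hsq hanti (c k) : R) = x k := by
  unfold toUnits c
  rw [PresentedGroup.toGroup.of]; simp
end toUnits

end CliffordGroup

open CliffordGroup

/-! ### Commuting the Hecke relations past Clifford generators -/

section ring
variable {K R : Type*} [Field K] [Ring R] [Algebra K R] {e : K}

theorem quadratic_mul_lo {s a b : R} (ha : s * a = b * s) (hb : s * b = a * s - e • (a - b)) :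
    (s * s - e • s - 1) * a = a * (s * s - e • s - 1) := by
  have hb' : ∀ x, s * (b * x) = a * (s * x) - e • (a * x - b * x) := fun x => by
    rw [← mul_assoc, hb]; simp only [sub_mul, smul_mul_assoc, mul_assoc]
  simp only [mul_assoc, mul_sub, sub_mul, smul_mul_assoc, mul_smul_comm, one_mul, mul_one, ha,
    hb']
  module

theorem quadratic_mul_hi {s a b : R} (ha : s * a = b * s) (hb : s * b = a * s - e • (a - b)) :
    (s * s - e • s - 1) * b = b * (s * s - e • s - 1) := by
  have ha' : ∀ x, s * (a * x) = b * (s * x) := fun x => by rw [← mul_assoc, ha, mul_assoc]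
  simp only [mul_assoc, mul_sub, sub_mul, smul_mul_assoc, mul_smul_comm, one_mul, mul_one, ha, hb,
    ha']
  module

theorem commutator_mul_lo {s t a b : R} (ha : s * a = b * s) (hta : t * a = a * t)
    (htb : t * b = b * t) : (s * t - t * s) * a = b * (s * t - t * s) := by
  rw [sub_mul, mul_assoc, hta, ← mul_assoc, ha, mul_assoc t, ha, ← mul_assoc t, htb, mul_sub]
  simp only [mul_assoc]

theorem commutator_mul_hi {s t a b : R} (hb : s * b = a * s - e • (a - b)) (hta : t * a = a * t)
    (htb : t * b = b * t) : (s * t - t * s) * b = a * (s * t - t * s) := by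
  have hta' : ∀ x, t * (a * x) = a * (t * x) := fun x => by rw [← mul_assoc, hta, mul_assoc]
  have hb' : ∀ x, s * (b * x) = a * (s * x) - e • (a * x - b * x) := fun x => by
    rw [← mul_assoc, hb]; simp only [sub_mul, smul_mul_assoc, mul_assoc]
  simp only [mul_assoc, mul_sub, sub_mul, mul_smul_comm, hta, htb, hb, hta', hb']
  module

/-- Past `a, b, c` the difference of the two sides of the braid relation moves by the permutation
that exchanges `a` and `c`. The case of `c` uses the quadratic relations. -/
theorem braid_mul {s t a b c : R} (hs : s * s = e • s + 1) (ht : t * t = e • t + 1)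
    (hsa : s * a = b * s) (hsb : s * b = a * s - e • (a - b)) (hsc : s * c = c * s)
    (hta : t * a = a * t) (htb : t * b = c * t) (htc : t * c = b * t - e • (b - c)) :
    (s * t * s - t * s * t) * a = c * (s * t * s - t * s * t) ∧
    (s * t * s - t * s * t) * b = b * (s * t * s - t * s * t) ∧
    (s * t * s - t * s * t) * c = a * (s * t * s - t * s * t) := by
  have hsa' : ∀ x, s * (a * x) = b * (s * x) := fun x => by rw [← mul_assoc, hsa, mul_assoc]
  have hsc' : ∀ x, s * (c * x) = c * (s * x) := fun x => by rw [← mul_assoc, hsc, mul_assoc]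
  have hta' : ∀ x, t * (a * x) = a * (t * x) := fun x => by rw [← mul_assoc, hta, mul_assoc]
  have htb' : ∀ x, t * (b * x) = c * (t * x) := fun x => by rw [← mul_assoc, htb, mul_assoc]
  have hsb' : ∀ x, s * (b * x) = a * (s * x) - e • (a * x - b * x) := fun x => by
    rw [← mul_assoc, hsb]; simp only [sub_mul, smul_mul_assoc, mul_assoc]
  have htc' : ∀ x, t * (c * x) = b * (t * x) - e • (b * x - c * x) := fun x => by
    rw [← mul_assoc, htc]; simp only [sub_mul, smul_mul_assoc, mul_assoc]
  refine ⟨?_, ?_, ?_⟩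
  · simp only [mul_assoc, mul_sub, sub_mul, hsa, hta, hsa', hsc', htb']
  all_goals
    simp only [mul_assoc, mul_sub, sub_mul, mul_add, mul_smul_comm,
      mul_one, smul_sub, smul_add, hs, ht, hsb, hsc, hta, htb, htc, hsa', hsb', hsc',
      hta', htb', htc']
    module
end ring

/-! ### The operators on odd functions -/

variable (n) in
/-- The functions on `CliffordGroup n × Perm (Fin n)` that change sign under `ζ`. -/
def oddSubmodule (K : Type*) [Field K] :
    Submodule K (CliffordGroup n × Perm (Fin n) → K) where
  carrier := {f | ∀ g u, f (zeta * g, u) = -f (g, u)}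
  add_mem' := fun hf hh g u => by simp [hf g u, hh g u]; ring
  zero_mem' := fun _ _ => by simp
  smul_mem' := fun a f hf g u => by simp [hf g u]

variable (n) in
/-- The type of odd functions. It is kept apart from the submodule `oddSubmodule n K` so that its
module structure is found without unfolding. -/
def OddFun (K : Type*) [Field K] : Type _ := oddSubmodule n K

section
variable {K : Type*} [Field K]

namespace OddFun

noncomputable instance : AddCommGroup (OddFun n K) :=
  inferInstanceAs (AddCommGroup (oddSubmodule n K))

noncomputable instance : Module K (OddFun n K) := inferInstanceAs (Module K (oddSubmodule n K))

instance : FiniteDimensional K (OddFun n K) :=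
  inferInstanceAs (FiniteDimensional K (oddSubmodule n K))

instance : CoeFun (OddFun n K) fun _ => CliffordGroup n × Perm (Fin n) → K := ⟨Subtype.val⟩

theorem apply_zeta_mul (f : OddFun n K) (g : CliffordGroup n) (u : Perm (Fin n)) :
    f (zeta * g, u) = -f (g, u) := f.2 g u

@[ext] theorem ext {f h : OddFun n K} (H : ∀ g u, f (g, u) = h (g, u)) : f = h :=
  Subtype.ext (funext fun p => H p.1 p.2)

def ofFun (F : CliffordGroup n × Perm (Fin n) → K)
    (hF : ∀ g u, F (zeta * g, u) = -F (g, u)) : OddFun n K := ⟨F, hF⟩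

@[simp] theorem ofFun_apply (F : CliffordGroup n × Perm (Fin n) → K)
    (hF : ∀ g u, F (zeta * g, u) = -F (g, u)) (p) : ofFun F hF p = F p := rfl

variable (f h : OddFun n K) (p : CliffordGroup n × Perm (Fin n))

@[simp] theorem add_apply : (f + h) p = f p + h p := rfl
@[simp] theorem sub_apply : (f - h) p = f p - h p := rfl
@[simp] theorem neg_apply : (-f) p = -f p := rfl
@[simp] theorem smul_apply (a : K) : (a • f) p = a * f p := rfl

end OddFun

/-- `e` if `u` has a descent at `k`, and `0` otherwise. -/
def descentCoeff (e : K) (k : Fin (n - 1)) (u : Perm (Fin n)) : K :=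
  if u (hi k) < u (lo k) then e else 0

/-- The operator of `C_k`. As functions transform by `(C_k f)(g, u) = f (c_k⁻¹ g, u)`, the sign comes
from `c_k⁻¹ = ζ c_k`. -/
noncomputable def cOp (k : Fin n) : Module.End K (OddFun n K) where
  toFun f := OddFun.ofFun (fun p => -f (c k * p.1, p.2)) (fun g u => by
    simp only
    rw [← mul_assoc, ← zeta_mul_c, mul_assoc, OddFun.apply_zeta_mul])
  map_add' f h := by ext; simp; ring
  map_smul' a f := by ext; simp

/-- The self-adjoint part of the operator of `T_k`. -/
noncomputable def symOp (e : K) (k : Fin (n - 1)) : Module.End K (OddFun n K) where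
  toFun f := OddFun.ofFun (fun p => f (permHom (adjSwap k) p.1, p.2 * adjSwap k)
      + descentCoeff e k p.2 * f (permHom (adjSwap k) p.1, p.2)
      + e / 2 * (f p - f (permHom (adjSwap k) p.1, p.2)
        - f (permHom (adjSwap k) p.1 * (c (lo k) * c (hi k)), p.2))) (fun g u => by
    simp only [map_mul, permHom_zeta, mul_assoc, OddFun.apply_zeta_mul]
    ring)
  map_add' f h := by ext; simp; ring
  map_smul' a f := by ext; simp; ring

/-- The operator of `T_k`. -/
noncomputable def tOp (e : K) (k : Fin (n - 1)) : Module.End K (OddFun n K) :=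
  symOp e k + (e / 2) • (cOp (lo k) * cOp (hi k))

/-- The adjoint of `tOp e k` (see `isAdj_tOp`). -/
noncomputable def tOpAdj (e : K) (k : Fin (n - 1)) : Module.End K (OddFun n K) :=
  symOp e k - (e / 2) • (cOp (lo k) * cOp (hi k))

theorem cOp_apply (k : Fin n) (f : OddFun n K) (g : CliffordGroup n) (u : Perm (Fin n)) :
    (cOp k f) (g, u) = -f (c k * g, u) := rfl

theorem symOp_apply (e : K) (k : Fin (n - 1)) (f : OddFun n K) (g : CliffordGroup n)
    (u : Perm (Fin n)) :
    (symOp e k f) (g, u) = f (permHom (adjSwap k) g, u * adjSwap k)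
      + descentCoeff e k u * f (permHom (adjSwap k) g, u)
      + e / 2 * (f (g, u) - f (permHom (adjSwap k) g, u)
        - f (permHom (adjSwap k) g * (c (lo k) * c (hi k)), u)) := rfl

theorem c_mul_c_mul (k : Fin n) (g : CliffordGroup n) : c k * (c k * g) = zeta * g := by
  rw [← mul_assoc, c_mul_self]

theorem c_hi_mul_c_lo_mul (k : Fin (n - 1)) (g : CliffordGroup n) :
    c (hi k) * (c (lo k) * g) = zeta * (c (lo k) * (c (hi k) * g)) := by
  rw [← mul_assoc, c_mul_c (lo_ne_hi k).symm]
  simp only [mul_assoc]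

theorem c_mul_zeta_mul (k : Fin n) (g : CliffordGroup n) :
    c k * (zeta * g) = zeta * (c k * g) := by
  rw [← mul_assoc, ← zeta_mul_c, mul_assoc]

theorem tOp_apply (e : K) (k : Fin (n - 1)) (f : OddFun n K) (g : CliffordGroup n)
    (u : Perm (Fin n)) :
    (tOp e k f) (g, u) = f (permHom (adjSwap k) g, u * adjSwap k)
      + descentCoeff e k u * f (permHom (adjSwap k) g, u)
      + e / 2 * (f (g, u) - f (permHom (adjSwap k) g, u)
        - f (permHom (adjSwap k) g * (c (lo k) * c (hi k)), u)
        - f (c (lo k) * (c (hi k) * g), u)) := by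
  have : (tOp e k f) (g, u) = (symOp e k f) (g, u)
    + e / 2 * (f (c (hi k) * (c (lo k) * g), u)) := by
      simp [tOp, cOp_apply]
  rw [this, symOp_apply, c_hi_mul_c_lo_mul, OddFun.apply_zeta_mul]
  ring

/-- At the identity of the Clifford group the adjoint of `T_k` acts by the regular representation of
the Hecke algebra. -/
theorem tOpAdj_apply_one (e : K) (k : Fin (n - 1)) (f : OddFun n K) (u : Perm (Fin n)) :
    (tOpAdj e k f) (1, u) = f (1, u * adjSwap k) + descentCoeff e k u * f (1, u) := by
  have : (tOpAdj e k f) (1, u) = (symOp e k f) (1, u)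
    - e / 2 * (f (c (hi k) * (c (lo k) * 1), u)) := by
      simp [tOpAdj, cOp_apply]
  rw [this, symOp_apply, c_hi_mul_c_lo_mul, OddFun.apply_zeta_mul]
  simp only [map_one, one_mul, mul_one]
  ring

theorem cOp_mul_self (k : Fin n) : cOp k * cOp k = (-1 : Module.End K (OddFun n K)) := by
  ext f g u
  simp [cOp_apply, c_mul_c_mul, OddFun.apply_zeta_mul]

theorem cOp_anticomm {k l : Fin n} (h : k ≠ l) :
    cOp k * cOp l = -(cOp l * cOp k : Module.End K (OddFun n K)) := by
  ext f g u
  have : c l * (c k * g) = zeta * (c k * (c l * g)) := by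
    rw [← mul_assoc, c_mul_c h.symm]
    simp only [mul_assoc]
  simp [cOp_apply, this, OddFun.apply_zeta_mul]

theorem tOp_mul_cOp_lo (e : K) (k : Fin (n - 1)) :
    tOp e k * cOp (lo k) = cOp (hi k) * tOp e k := by
  ext f g u
  simp only [Module.End.mul_apply, cOp_apply, tOp_apply, map_mul, permHom_c, adjSwap_hi, mul_assoc,
    c_mul_c_mul, c_mul_zeta_mul, OddFun.apply_zeta_mul]
  ring

theorem tOp_mul_cOp_of_ne (e : K) {k : Fin (n - 1)} {l : Fin n} (h₁ : l ≠ lo k) (h₂ : l ≠ hi k) :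
    tOp e k * cOp l = cOp l * tOp e k := by
  ext f g u
  have h3 : c l * (c (lo k) * (c (hi k) * g)) = c (lo k) * (c (hi k) * (c l * g)) := by
    rw [← mul_assoc (c l), c_mul_c h₁, ← mul_assoc (c (hi k)), c_mul_c h₂.symm]
    simp only [mul_assoc]
    simp only [c_mul_zeta_mul]
  simp only [Module.End.mul_apply, cOp_apply, tOp_apply, map_mul, permHom_c,
    adjSwap_of_ne h₁ h₂, mul_assoc, h3]
  ring

variable [NeZero (2 : K)]

theorem tOp_mul_cOp_hi (e : K) (k : Fin (n - 1)) :
    tOp e k * cOp (hi k) = cOp (lo k) * tOp e k - e • (cOp (lo k) - cOp (hi k)) := by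
  ext f g u
  simp only [Module.End.mul_apply, LinearMap.sub_apply, LinearMap.smul_apply,
    OddFun.sub_apply, OddFun.smul_apply,
    cOp_apply, tOp_apply, map_mul, permHom_c, adjSwap_lo, mul_assoc,
    c_hi_mul_c_lo_mul, c_mul_c_mul, c_mul_zeta_mul, OddFun.apply_zeta_mul]
  field_simp
  ring

end

/-! ### The Hermitian form and adjoints -/

section
variable {K : Type*} [Field K] (σ : K →+* K)

variable (n) in
/-- The form `⟨f, h⟩ = ∑ σ(f p) h p`. -/
noncomputable def pairing : OddFun n K →ₛₗ[σ] OddFun n K →ₗ[K] K :=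
  LinearMap.mk₂'ₛₗ σ (RingHom.id K) (fun f h => ∑ p, σ (f p) * h p)
    (fun f g h => by simp [add_mul, Finset.sum_add_distrib])
    (fun a f h => by simp [Finset.mul_sum, mul_assoc])
    (fun f g h => by simp [mul_add, Finset.sum_add_distrib])
    (fun a f h => by simp [Finset.mul_sum, mul_left_comm])

theorem pairing_apply (f h : OddFun n K) : pairing n σ f h = ∑ p, σ (f p) * h p := rfl

/-- `Y` is the right adjoint of `X` for the form `pairing n σ`. -/
def IsAdj (X Y : Module.End K (OddFun n K)) : Prop :=
  ∀ f h, pairing n σ (X f) h = pairing n σ f (Y h)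

variable {σ}

theorem IsAdj.one : IsAdj σ (1 : Module.End K (OddFun n K)) 1 := fun _ _ => rfl

theorem IsAdj.mul {X Y X' Y' : Module.End K (OddFun n K)} (h : IsAdj σ X Y) (h' : IsAdj σ X' Y') :
    IsAdj σ (X * X') (Y' * Y) := fun f g => by
  rw [Module.End.mul_apply, Module.End.mul_apply, h, h']

theorem IsAdj.add {X Y X' Y' : Module.End K (OddFun n K)} (h : IsAdj σ X Y) (h' : IsAdj σ X' Y') :
    IsAdj σ (X + X') (Y + Y') := fun f g => by
  simp only [LinearMap.add_apply, map_add, h f g, h' f g]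

theorem IsAdj.sub {X Y X' Y' : Module.End K (OddFun n K)} (h : IsAdj σ X Y) (h' : IsAdj σ X' Y') :
    IsAdj σ (X - X') (Y - Y') := fun f g => by
  simp only [LinearMap.sub_apply, map_sub, h f g, h' f g]

theorem IsAdj.smul {X Y : Module.End K (OddFun n K)} (h : IsAdj σ X Y) {a : K} (ha : σ a = a) :
    IsAdj σ (a • X) (a • Y) := fun f g => by
  simp only [LinearMap.smul_apply, map_smul, LinearMap.map_smulₛₗ, h f g, ha]

theorem IsAdj.unique (hσ : ∀ f, pairing n σ f f = 0 → f = 0)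
    {X Y Z : Module.End K (OddFun n K)} (h : IsAdj σ X Y) (h' : IsAdj σ X Z) : Y = Z := by
  ext1 f
  rw [← sub_eq_zero]
  apply hσ
  rw [map_sub, ← h, ← h', sub_self]

theorem IsAdj.eq_zero (hσ : ∀ f, pairing n σ f f = 0 → f = 0)
    {X : Module.End K (OddFun n K)} (h : IsAdj σ X 0) : X = 0 := by
  ext1 f
  apply hσ
  rw [h, LinearMap.zero_apply, map_zero]

theorem isAdj_cOp (k : Fin n) : IsAdj σ (cOp k) (-cOp k : Module.End K (OddFun n K)) := by
  intro f h
  rw [pairing_apply, pairing_apply,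
    ← Equiv.sum_comp ((Equiv.mulLeft (c k)).prodCongr (Equiv.refl _))]
  refine Finset.sum_congr rfl fun ⟨g, u⟩ _ => ?_
  simp only [Equiv.prodCongr_apply, Prod.map, Equiv.coe_mulLeft, Equiv.refl_apply, cOp_apply,
    c_mul_c_mul, OddFun.apply_zeta_mul, LinearMap.neg_apply, OddFun.neg_apply, neg_neg]

theorem sum_mul_comp_involutive {ι : Type*} [Fintype ι] {π : ι → ι} (hπ : Function.Involutive π)
    {M : Type*} [AddCommMonoid M] (F : ι → ι → M) : ∑ p, F (π p) p = ∑ p, F p (π p) := by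
  rw [← Equiv.sum_comp hπ.toPerm]
  simp [hπ _]

/-- The substitution in the first term of `symOp`. -/
def swapBoth (k : Fin (n - 1)) (p : CliffordGroup n × Perm (Fin n)) :
    CliffordGroup n × Perm (Fin n) := (permHom (adjSwap k) p.1, p.2 * adjSwap k)

/-- The substitution `(g, u) ↦ (s g, u)` in `symOp`. -/
def swapFst (k : Fin (n - 1)) (p : CliffordGroup n × Perm (Fin n)) :
    CliffordGroup n × Perm (Fin n) := (permHom (adjSwap k) p.1, p.2)

/-- The substitution `(g, u) ↦ (s(g) ab, u)` in `symOp`. It is an involution because `s(ab) = ba` is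
the inverse of `ab`. -/
def swapFstMul (k : Fin (n - 1)) (p : CliffordGroup n × Perm (Fin n)) :
    CliffordGroup n × Perm (Fin n) := (permHom (adjSwap k) p.1 * (c (lo k) * c (hi k)), p.2)

theorem permHom_adjSwap_permHom (k : Fin (n - 1)) (g : CliffordGroup n) :
    permHom (adjSwap k) (permHom (adjSwap k) g) = g :=
  permHom_permHom_of_mul_self (adjSwap_adjSwap k) g

theorem swapBoth_involutive (k : Fin (n - 1)) : Function.Involutive (swapBoth k) := fun p => by
  simp [swapBoth, permHom_adjSwap_permHom]

theorem swapFst_involutive (k : Fin (n - 1)) : Function.Involutive (swapFst k) := fun p => by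
  simp [swapFst, permHom_adjSwap_permHom]

theorem swapFstMul_involutive (k : Fin (n - 1)) : Function.Involutive (swapFstMul k) := fun p => by
  have : c (hi k) * c (lo k) * (c (lo k) * c (hi k)) = 1 := by
    rw [mul_assoc, c_mul_c_mul, zeta_mul_c, ← mul_assoc, c_mul_self, zeta_mul_zeta]
  simp [swapFstMul, permHom_adjSwap_permHom, mul_assoc _ (c (hi k) * c (lo k)), this]

theorem symOp_apply' (e : K) (k : Fin (n - 1)) (f : OddFun n K) (p) :
    (symOp e k f) p = f (swapBoth k p) + descentCoeff e k p.2 * f (swapFst k p)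
      + e / 2 * (f p - f (swapFst k p) - f (swapFstMul k p)) := rfl

theorem isAdj_symOp {e : K} (he : σ e = e) (k : Fin (n - 1)) :
    IsAdj σ (symOp (n := n) e k) (symOp e k) := by
  intro f h
  have hd : ∀ u, σ (descentCoeff (n := n) e k u) = descentCoeff e k u := fun u => by
    unfold descentCoeff; split_ifs <;> simp [he]
  have he2 : σ (e / 2) = e / 2 := by rw [map_div₀, he, map_ofNat]
  have h1 := sum_mul_comp_involutive (swapBoth_involutive k) fun p p' => σ (f p) * h p'
  have h2 := sum_mul_comp_involutive (swapFst_involutive k)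
    fun p p' => descentCoeff e k p'.2 * (σ (f p) * h p')
  have h3 := sum_mul_comp_involutive (swapFst_involutive k) fun p p' => σ (f p) * h p'
  have h4 := sum_mul_comp_involutive (swapFstMul_involutive k) fun p p' => σ (f p) * h p'
  calc pairing n σ (symOp e k f) h = ∑ p, σ (f (swapBoth k p)) * h p
        + ∑ p, descentCoeff e k p.2 * (σ (f (swapFst k p)) * h p)
        + e / 2 * (∑ p, σ (f p) * h p - ∑ p, σ (f (swapFst k p)) * h p
          - ∑ p, σ (f (swapFstMul k p)) * h p) := by
        rw [pairing_apply]
        simp only [← Finset.sum_sub_distrib, Finset.mul_sum, ← Finset.sum_add_distrib]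
        refine Finset.sum_congr rfl fun p _ => ?_
        simp only [symOp_apply', map_add, map_sub, map_mul, hd, he2]
        ring
    _ = ∑ p, σ (f p) * h (swapBoth k p)
        + ∑ p, descentCoeff e k p.2 * (σ (f p) * h (swapFst k p))
        + e / 2 * (∑ p, σ (f p) * h p - ∑ p, σ (f p) * h (swapFst k p)
          - ∑ p, σ (f p) * h (swapFstMul k p)) := by
        rw [h1, h2, h3, h4]; rfl
    _ = pairing n σ f (symOp e k h) := by
        rw [pairing_apply]
        simp only [← Finset.sum_sub_distrib, Finset.mul_sum, ← Finset.sum_add_distrib]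
        refine Finset.sum_congr rfl fun p _ => ?_
        simp only [symOp_apply']
        ring

theorem isAdj_cOp_mul_cOp {k l : Fin n} (h : k ≠ l) :
    IsAdj σ (cOp k * cOp l) (-(cOp k * cOp l) : Module.End K (OddFun n K)) := by
  have := (isAdj_cOp (σ := σ) (K := K) k).mul (isAdj_cOp l)
  rwa [neg_mul_neg, cOp_anticomm h.symm] at this

theorem isAdj_tOp {e : K} (he : σ e = e) (k : Fin (n - 1)) :
    IsAdj σ (tOp (n := n) e k) (tOpAdj e k) := by
  have he2 : σ (e / 2) = e / 2 := by rw [map_div₀, he, map_ofNat]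
  have := (isAdj_symOp he k).add ((isAdj_cOp_mul_cOp (lo_ne_hi k)).smul he2)
  rwa [smul_neg, ← sub_eq_add_neg] at this

theorem isAdj_tOpAdj {e : K} (he : σ e = e) (k : Fin (n - 1)) :
    IsAdj σ (tOpAdj (n := n) e k) (tOp e k) := by
  have he2 : σ (e / 2) = e / 2 := by rw [map_div₀, he, map_ofNat]
  have := (isAdj_symOp he k).sub ((isAdj_cOp_mul_cOp (lo_ne_hi k)).smul he2)
  rwa [smul_neg, sub_neg_eq_add] at this

/-- An operator that commutes past the `C_k` up to a change of index is zero once its adjoint vanishes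
at the points `(1, u)`: left translation by the `c_k` carries this to all points. -/
theorem IsAdj.eq_zero_of_apply_one (hσ : ∀ f, pairing n σ f f = 0 → f = 0)
    {X Y : Module.End K (OddFun n K)} (h : IsAdj σ X Y) (hX : ∀ k, ∃ l, X * cOp k = cOp l * X)
    (hY : ∀ f u, (Y f) (1, u) = 0) : X = 0 := by
  have hYc : ∀ k, ∃ l, cOp k * Y = Y * cOp l := by
    intro k
    obtain ⟨l, hl⟩ := hX k
    refine ⟨l, ?_⟩
    have h1 := h.mul (isAdj_cOp k)
    have h2 := (isAdj_cOp l).mul h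
    rw [← hl] at h2
    simpa using h1.unique hσ h2
  have hY' : ∀ (g : CliffordGroup n) f u, (Y f) (g, u) = 0 := by
    intro g
    induction g using induction_left with
    | one => exact hY
    | zeta_mul g ih => intro f u; rw [OddFun.apply_zeta_mul, ih, neg_zero]
    | c_mul k g ih =>
      intro f u
      obtain ⟨l, hl⟩ := hYc k
      have := cOp_apply k (Y f) g u
      rw [← Module.End.mul_apply, hl, Module.End.mul_apply, ih] at this
      exact neg_eq_zero.1 this.symm
  have hY0 : Y = 0 := by
    ext f g u
    exact hY' g f u
  subst hY0
  exact h.eq_zero hσ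

/-! ### The Hecke relations for the operators -/

variable [NeZero (2 : K)] {e : K} (he : σ e = e) (hσ : ∀ f, pairing n σ f f = 0 → f = 0)
include he hσ

theorem tOp_quadratic (k : Fin (n - 1)) :
    (tOp e k * tOp e k : Module.End K (OddFun n K)) = e • tOp e k + 1 := by
  have ha := tOp_mul_cOp_lo (n := n) e k
  have hb := tOp_mul_cOp_hi (n := n) e k
  have key : (tOp e k * tOp e k - e • tOp e k - 1 : Module.End K (OddFun n K)) = 0 := by
    refine IsAdj.eq_zero_of_apply_one hσ ((((isAdj_tOp he k).mul (isAdj_tOp he k)).sub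
      ((isAdj_tOp he k).smul he)).sub IsAdj.one) (fun l => ⟨l, ?_⟩) fun f u => ?_
    · rcases eq_or_ne l (lo k) with rfl | h₁
      · exact quadratic_mul_lo ha hb
      rcases eq_or_ne l (hi k) with rfl | h₂
      · exact quadratic_mul_hi ha hb
      have hc := tOp_mul_cOp_of_ne (n := n) e h₁ h₂
      rw [sub_mul, sub_mul, mul_assoc, hc, ← mul_assoc, hc, smul_mul_assoc, hc, mul_sub, mul_sub,
        mul_assoc, mul_smul_comm, one_mul, mul_one]
    · have h1 : ∀ A B D : OddFun n K, (A - e • B - D).1 (1, u)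
        = A.1 (1, u) - e * B.1 (1, u) - D.1 (1, u) := fun _ _ _ => rfl
      change (tOpAdj e k (tOpAdj e k f) - e • tOpAdj e k f - f) (1, u) = 0
      simp only [OddFun.sub_apply, OddFun.smul_apply, tOpAdj_apply_one,
        mul_adjSwap_mul_adjSwap, descentCoeff, Perm.mul_apply, adjSwap_lo, adjSwap_hi]
      rcases lt_or_gt_of_ne (u.injective.ne (lo_ne_hi k)) with h | h
      · simp [h, h.asymm]
      · simp [h, h.asymm]
  rw [sub_sub, sub_eq_zero] at key
  exact key

theorem tOp_comm {k l : Fin (n - 1)} (h : k.val + 1 < l.val ∨ l.val + 1 < k.val) :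
    (tOp e k * tOp e l : Module.End K (OddFun n K)) = tOp e l * tOp e k := by
  have hne : ∀ {k l : Fin (n - 1)}, k.val + 1 < l.val ∨ l.val + 1 < k.val →
      lo l ≠ lo k ∧ lo l ≠ hi k ∧ hi l ≠ lo k ∧ hi l ≠ hi k := by
    intro k l h
    simp only [lo, hi, ne_eq, Fin.ext_iff]
    omega
  obtain ⟨h1, h2, h3, h4⟩ := hne h
  obtain ⟨h1', h2', h3', h4'⟩ := hne h.symm
  have ka := tOp_mul_cOp_lo (K := K) (n := n) e k
  have kb := tOp_mul_cOp_hi (K := K) (n := n) e k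
  have la := tOp_mul_cOp_lo (K := K) (n := n) e l
  have lb := tOp_mul_cOp_hi (K := K) (n := n) e l
  have ka' := tOp_mul_cOp_of_ne (K := K) e h1' h2'
  have kb' := tOp_mul_cOp_of_ne (K := K) e h3' h4'
  have la' := tOp_mul_cOp_of_ne (K := K) e h1 h2
  have lb' := tOp_mul_cOp_of_ne (K := K) e h3 h4
  rw [← sub_eq_zero]
  refine IsAdj.eq_zero_of_apply_one hσ (((isAdj_tOp he k).mul (isAdj_tOp he l)).sub
      ((isAdj_tOp he l).mul (isAdj_tOp he k))) (fun m => ?_) fun f u => ?_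
  · rcases eq_or_ne m (lo k) with rfl | h₁
    · exact ⟨hi k, commutator_mul_lo ka ka' kb'⟩
    rcases eq_or_ne m (hi k) with rfl | h₂
    · exact ⟨lo k, commutator_mul_hi kb ka' kb'⟩
    rcases eq_or_ne m (lo l) with rfl | h₃
    · refine ⟨hi l, ?_⟩
      have := commutator_mul_lo la la' lb'
      rw [← neg_sub, neg_mul, this, mul_neg]
    rcases eq_or_ne m (hi l) with rfl | h₄
    · refine ⟨lo l, ?_⟩
      have := commutator_mul_hi lb la' lb'
      rw [← neg_sub, neg_mul, this, mul_neg]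
    exact ⟨m, commutator_mul_lo (tOp_mul_cOp_of_ne e h₁ h₂) (tOp_mul_cOp_of_ne e h₃ h₄)
      (tOp_mul_cOp_of_ne e h₃ h₄)⟩
  · change (tOpAdj e l (tOpAdj e k f) - tOpAdj e k (tOpAdj e l f)).1 (1, u) = 0
    simp only [OddFun.sub_apply, tOpAdj_apply_one, descentCoeff, Perm.mul_apply, adjSwap_lo_of_far h,
      adjSwap_hi_of_far h, adjSwap_lo_of_far h.symm, adjSwap_hi_of_far h.symm, mul_assoc u,
      adjSwap_comm h]
    ring

theorem tOp_braid {k l : Fin (n - 1)} (h : l.val = k.val + 1) :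
    (tOp e k * tOp e l * tOp e k : Module.End K (OddFun n K)) = tOp e l * tOp e k * tOp e l := by
  have hlk : lo l = hi k := Fin.ext h
  have hlo : lo k ≠ lo l ∧ lo k ≠ hi l := by simp only [lo, hi, ne_eq, Fin.ext_iff]; omega
  have hhi : hi l ≠ lo k ∧ hi l ≠ hi k := by simp only [lo, hi, ne_eq, Fin.ext_iff]; omega
  have la := tOp_mul_cOp_lo (K := K) (n := n) e l
  have lb := tOp_mul_cOp_hi (K := K) (n := n) e l
  rw [hlk] at la lb
  obtain ⟨ba, bb, bc⟩ := braid_mul (tOp_quadratic he hσ k) (tOp_quadratic he hσ l)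
    (tOp_mul_cOp_lo e k) (tOp_mul_cOp_hi e k) (tOp_mul_cOp_of_ne e hhi.1 hhi.2)
    (tOp_mul_cOp_of_ne e hlo.1 hlo.2) la lb
  rw [← sub_eq_zero]
  refine IsAdj.eq_zero_of_apply_one hσ
    ((((isAdj_tOp he k).mul (isAdj_tOp he l)).mul (isAdj_tOp he k)).sub
      (((isAdj_tOp he l).mul (isAdj_tOp he k)).mul (isAdj_tOp he l))) (fun m => ?_) fun f u => ?_
  · rcases eq_or_ne m (lo k) with rfl | h₁
    · exact ⟨_, ba⟩
    rcases eq_or_ne m (hi k) with rfl | h₂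
    · exact ⟨_, bb⟩
    rcases eq_or_ne m (hi l) with rfl | h₃
    · exact ⟨_, bc⟩
    have hk := tOp_mul_cOp_of_ne (K := K) e h₁ h₂
    have hl := tOp_mul_cOp_of_ne (K := K) (k := l) e (hlk ▸ h₂) h₃
    refine ⟨m, ?_⟩
    have hk' : ∀ X, tOp e k * (cOp m * X) = cOp m * (tOp e k * X) := fun X => by
      rw [← mul_assoc, hk, mul_assoc]
    have hl' : ∀ X, tOp e l * (cOp m * X) = cOp m * (tOp e l * X) := fun X => by
      rw [← mul_assoc, hl, mul_assoc]
    simp only [sub_mul, mul_sub, mul_assoc, hk, hl, hk', hl']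
  · change (tOpAdj e k (tOpAdj e l (tOpAdj e k f))
      - tOpAdj e l (tOpAdj e k (tOpAdj e l f))).1 (1, u) = 0
    have hbr : u * adjSwap l * adjSwap k * adjSwap l = u * adjSwap k * adjSwap l * adjSwap k := by
      have := adjSwap_braid h
      simp only [mul_assoc] at this ⊢
      rw [this]
    have e1 := adjSwap_lo_of_adjacent h
    have e2 := adjSwap_hi_of_adjacent h
    have e3 : adjSwap l (hi k) = hi l := by rw [← hlk, adjSwap_lo]
    have e4 : adjSwap l (hi l) = hi k := by rw [← hlk, adjSwap_hi]
    simp only [OddFun.sub_apply, tOpAdj_apply_one, descentCoeff,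
      mul_adjSwap_mul_adjSwap, Perm.mul_apply, hlk,
      adjSwap_lo, adjSwap_hi, e1, e2, e3, e4, hbr]
    have n1 := lt_or_gt_of_ne (u.injective.ne (lo_ne_hi k))
    have n2 := lt_or_gt_of_ne (u.injective.ne hhi.2)
    have n3 := lt_or_gt_of_ne (u.injective.ne hhi.1)
    -- Two of the eight sign patterns contradict transitivity; the others are the six orderings of
    -- three letters.
    rcases n1 with n1 | n1 <;> rcases n2 with n2 | n2 <;> rcases n3 with n3 | n3 <;>
      first
      | (exfalso; order)
      | (simp only [n1, n2, n3, n1.asymm, n2.asymm, n3.asymm, if_true, if_false]; ring)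

end

/-! ### Families satisfying the Hecke–Clifford relations -/

variable {K : Type*} [Field K]

/-- Families `T`, `C` in an algebra that satisfy the defining relations of the Hecke–Clifford algebra
with `q - q⁻¹ = e`. The quadratic relation is written as `T² = e T + 1`. -/
structure IsHeckeCliffordFamily {R : Type*} [Ring R] [Algebra K R] (e : K)
    (T : Fin (n - 1) → R) (C : Fin n → R) : Prop where
  quadratic (k) : T k * T k = e • T k + 1
  braid (k l : Fin (n - 1)) : l.val = k.val + 1 → T k * T l * T k = T l * T k * T l
  comm (k l : Fin (n - 1)) : k.val + 1 < l.val ∨ l.val + 1 < k.val → T k * T l = T l * T k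
  square (k) : C k * C k = -1
  anticomm (k l) : k ≠ l → C k * C l = -(C l * C k)
  crossLo (k) : T k * C (lo k) = C (hi k) * T k
  crossHi (k) : T k * C (hi k) = C (lo k) * T k - e • (C (lo k) - C (hi k))
  crossComm (k l) : l ≠ lo k → l ≠ hi k → T k * C l = C l * T k

theorem isHeckeCliffordFamily_op {σ : K →+* K} [NeZero (2 : K)] {e : K} (he : σ e = e)
    (hσ : ∀ f, pairing n σ f f = 0 → f = 0) :
    IsHeckeCliffordFamily (R := Module.End K (OddFun n K)) e (tOp e) cOp where
  quadratic k := tOp_quadratic he hσ k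
  braid _ _ h := tOp_braid he hσ h
  comm _ _ h := tOp_comm he hσ h
  square k := cOp_mul_self k
  anticomm _ _ h := cOp_anticomm h
  crossLo k := tOp_mul_cOp_lo e k
  crossHi k := tOp_mul_cOp_hi e k
  crossComm _ _ h₁ h₂ := tOp_mul_cOp_of_ne e h₁ h₂

/-! ### The map from odd functions to the algebra -/

section family
variable {R : Type*} [Ring R] [Algebra K R] {e : K} {T : Fin (n - 1) → R} {C : Fin n → R}
  (H : IsHeckeCliffordFamily e T C)

/-- The Clifford monomials in `R`, as a representation of the Clifford group. -/
noncomputable def cliffordToAlg : CliffordGroup n →* R :=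
  (Units.coeHom _).comp (toUnits C H.square H.anticomm)

theorem cliffordToAlg_zeta : cliffordToAlg H (zeta : CliffordGroup n) = -1 :=
  toUnits_zeta C H.square H.anticomm

theorem cliffordToAlg_c (k : Fin n) : cliffordToAlg H (c k) = C k :=
  toUnits_c C H.square H.anticomm k

include H in
theorem T_mul_reducedProd (k : Fin (n - 1)) (u : Perm (Fin n)) :
    T k * reducedProd T u
      = reducedProd T (u * adjSwap k)
        + descentCoeff e k u • reducedProd T u := by
  have hred := reducedProd_eq_mul H.braid H.comm
  rcases lt_or_gt_of_ne (u.injective.ne (lo_ne_hi k)) with h | h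
  · have h' : (u * adjSwap k) (hi k) < (u * adjSwap k) (lo k) := by simpa using h
    rw [hred _ k h', mul_adjSwap_mul_adjSwap, descentCoeff, if_neg h.asymm, zero_smul, add_zero]
  · rw [hred u k h, ← mul_assoc, H.quadratic, descentCoeff, if_pos h, add_mul, one_mul,
      smul_mul_assoc, add_comm]

/-- The cross relations for all Clifford monomials at once. Up to the factor `e`, the correction term
is the inner twisted derivation `g ↦ z g - s(g) z` with `z = (1 + ab) / 2`. -/
theorem T_mul_cliffordToAlg [NeZero (2 : K)] (k : Fin (n - 1)) (g : CliffordGroup n) :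
    T k * cliffordToAlg H g = cliffordToAlg H (permHom (adjSwap k) g) * T k
      + (e / 2) • (cliffordToAlg H g + C (lo k) * (C (hi k) * cliffordToAlg H g)
        - cliffordToAlg H (permHom (adjSwap k) g)
        - cliffordToAlg H (permHom (adjSwap k) g) * (C (lo k) * C (hi k))) := by
  have ha : ∀ x, C (lo k) * (C (lo k) * x) = -x := fun x => by
    rw [← mul_assoc, H.square, neg_one_mul]
  have hb : ∀ x, C (hi k) * (C (hi k) * x) = -x := fun x => by
    rw [← mul_assoc, H.square, neg_one_mul]
  have hba : ∀ x, C (hi k) * (C (lo k) * x) = -(C (lo k) * (C (hi k) * x)) :=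
    fun x => by rw [← mul_assoc, H.anticomm _ _ (lo_ne_hi k).symm, neg_mul, mul_assoc]
  induction g using induction_left with
  | one => simp
  | zeta_mul g ih =>
    simp only [map_mul, permHom_zeta, cliffordToAlg_zeta, mul_neg, neg_mul, one_mul, ih]
    module
  | c_mul l g ih =>
    simp only [map_mul, permHom_c, cliffordToAlg_c]
    rcases eq_or_ne l (lo k) with rfl | h₁
    · rw [← mul_assoc, H.crossLo, mul_assoc, ih, adjSwap_lo]
      simp only [mul_add, mul_sub, mul_smul_comm, mul_assoc, hba, ha, hb, mul_neg]
      module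
    rcases eq_or_ne l (hi k) with rfl | h₂
    · rw [← mul_assoc, H.crossHi, sub_mul, mul_assoc, ih, adjSwap_hi]
      have h2 : ∀ x : R, e • x = (e / 2) • x + (e / 2) • x := fun x => by
        rw [← add_smul, add_halves]
      rw [h2]
      simp only [mul_add, add_mul, mul_sub, sub_mul, smul_mul_assoc, mul_smul_comm, mul_assoc,
        ha, hb, mul_neg]
      module
    · have h3 : ∀ x, C l * (C (lo k) * (C (hi k) * x))
          = C (lo k) * (C (hi k) * (C l * x)) := fun x => by
        rw [← mul_assoc, H.anticomm _ _ h₁, neg_mul, mul_assoc, ← mul_assoc (C l),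
          H.anticomm _ _ h₂, neg_mul, mul_neg, neg_neg, mul_assoc]
      rw [← mul_assoc, H.crossComm _ _ h₁ h₂, mul_assoc, ih, adjSwap_of_ne h₁ h₂]
      simp only [mul_add, mul_sub, mul_smul_comm, mul_assoc, h3]

/-- The spanning element `g T_u` of the algebra. -/
noncomputable def basisElt (p : CliffordGroup n × Perm (Fin n)) : R :=
  cliffordToAlg H p.1 * reducedProd T p.2

theorem T_mul_basisElt [NeZero (2 : K)] (k : Fin (n - 1)) (p : CliffordGroup n × Perm (Fin n)) :
    T k * basisElt H p = basisElt H (swapBoth k p)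
      + descentCoeff e k p.2 • basisElt H (swapFst k p)
      + (e / 2) • (basisElt H p - basisElt H (swapFst k p) - basisElt H (swapFstMul k p))
      + (e / 2) • (C (lo k) * (C (hi k) * basisElt H p)) := by
  simp only [basisElt, swapBoth, swapFst, swapFstMul, map_mul, cliffordToAlg_c]
  rw [← mul_assoc, T_mul_cliffordToAlg, add_mul, mul_assoc, T_mul_reducedProd H]
  simp only [add_mul, sub_mul, mul_add, mul_smul_comm, smul_mul_assoc, mul_assoc]
  module

/-- The linear map `f ↦ ∑ f(g, u) g T_u`. -/
noncomputable def toAlg : OddFun n K →ₗ[K] R where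
  toFun f := ∑ p, f p • basisElt H p
  map_add' f h := by simp [add_smul, Finset.sum_add_distrib]
  map_smul' a f := by simp [mul_smul, Finset.smul_sum]

theorem toAlg_apply (f : OddFun n K) : toAlg H f = ∑ p, f p • basisElt H p := rfl

theorem toAlg_cOp (k : Fin n) (f : OddFun n K) : toAlg H (cOp k f) = C k * toAlg H f := by
  rw [toAlg_apply, toAlg_apply, Finset.mul_sum,
    ← Equiv.sum_comp ((Equiv.mulLeft (c k)).prodCongr (Equiv.refl _))]
  refine Finset.sum_congr rfl fun ⟨g, u⟩ _ => ?_
  simp only [Equiv.prodCongr_apply, Prod.map, Equiv.coe_mulLeft, Equiv.refl_apply, cOp_apply,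
    c_mul_c_mul, OddFun.apply_zeta_mul, neg_neg, basisElt, map_mul, cliffordToAlg_c,
    mul_smul_comm, mul_assoc]

theorem toAlg_symOp (k : Fin (n - 1)) (f : OddFun n K) : toAlg H (symOp e k f)
    = ∑ p, f p • (basisElt H (swapBoth k p)
      + descentCoeff e k p.2 • basisElt H (swapFst k p)
      + (e / 2) •
        (basisElt H p - basisElt H (swapFst k p) - basisElt H (swapFstMul k p))) := by
  have h1 := sum_mul_comp_involutive (swapBoth_involutive k) fun p p' => f p • basisElt H p'
  have h2 := sum_mul_comp_involutive (swapFst_involutive k)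
    fun p p' => descentCoeff e k p'.2 • f p • basisElt H p'
  have h3 := sum_mul_comp_involutive (swapFst_involutive k) fun p p' => f p • basisElt H p'
  have h4 := sum_mul_comp_involutive (swapFstMul_involutive k) fun p p' => f p • basisElt H p'
  calc toAlg H (symOp e k f) = ∑ p, f (swapBoth k p) • basisElt H p
        + ∑ p, descentCoeff e k p.2 • f (swapFst k p) • basisElt H p
        + (e / 2) • (∑ p, f p • basisElt H p - ∑ p, f (swapFst k p) • basisElt H p
          - ∑ p, f (swapFstMul k p) • basisElt H p) := by
        rw [toAlg_apply]
        simp only [← Finset.sum_sub_distrib, Finset.smul_sum, ← Finset.sum_add_distrib]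
        refine Finset.sum_congr rfl fun p _ => ?_
        rw [symOp_apply']
        module
    _ = _ := by
        rw [h1, h2, h3, h4]
        simp only [← Finset.sum_sub_distrib, Finset.smul_sum, ← Finset.sum_add_distrib]
        refine Finset.sum_congr rfl fun p _ => ?_
        simp only [swapFst]
        module

theorem toAlg_tOp [NeZero (2 : K)] (k : Fin (n - 1)) (f : OddFun n K) :
    toAlg H (tOp e k f) = T k * toAlg H f := by
  have h : tOp e k f = symOp e k f
    + (e / 2) • cOp (lo k) (cOp (hi k) f) := rfl
  rw [h, map_add, map_smul, toAlg_cOp, toAlg_cOp, toAlg_symOp, toAlg_apply]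
  simp only [Finset.mul_sum, Finset.smul_sum, ← Finset.sum_add_distrib, mul_smul_comm]
  refine Finset.sum_congr rfl fun p _ => ?_
  rw [T_mul_basisElt]
  module

/-- The value `2` is attained at the odd function `δ_(1,1) - δ_(ζ,1)`. -/
theorem toAlg_exists_eq_two : ∃ f : OddFun n K, toAlg H f = 2 := by
  classical
  let δ (g : CliffordGroup n) (p : CliffordGroup n × Perm (Fin n)) : K :=
    if p = (g, 1) then 1 else 0
  refine ⟨OddFun.ofFun (fun p => δ 1 p - δ zeta p) fun g u => ?_, ?_⟩
  · have h1 : zeta * g = 1 ↔ g = zeta := by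
      rw [mul_eq_one_iff_eq_inv', zeta_inv]
    have h2 : zeta * g = zeta ↔ g = 1 := mul_eq_left
    simp [δ, h1, h2]
  · simp only [toAlg_apply, OddFun.ofFun_apply, δ, sub_smul, ite_smul, one_smul, zero_smul,
      Finset.sum_sub_distrib, Finset.sum_ite_eq', Finset.mem_univ, if_true, basisElt, map_one,
      reducedProd_one, cliffordToAlg_zeta, mul_one, sub_neg_eq_add, one_add_one_eq_two]

/-! ### Semisimplicity -/

section
variable {σ : K →+* K} [NeZero (2 : K)] (hgen : Algebra.adjoin K (Set.range T ∪ Set.range C) = ⊤)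
  {α : R →ₐ[K] Module.End K (OddFun n K)} (hT : ∀ k, α (T k) = tOp e k) (hC : ∀ k, α (C k) = cOp k)
include hgen hT hC

theorem toAlg_action (x : R) (f : OddFun n K) :
    toAlg H (α x f) = x * toAlg H f := by
  have hx : x ∈ Algebra.adjoin K (Set.range T ∪ Set.range C) := by rw [hgen]; trivial
  induction hx using Algebra.adjoin_induction generalizing f with
  | mem x hx =>
    rcases hx with ⟨k, rfl⟩ | ⟨k, rfl⟩
    · rw [hT, toAlg_tOp]
    · rw [hC, toAlg_cOp]
  | algebraMap a =>
    rw [AlgHom.commutes, Module.algebraMap_end_apply, map_smul, Algebra.smul_def]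
  | add x y _ _ hx hy => rw [map_add, LinearMap.add_apply, map_add, hx, hy, add_mul]
  | mul x y _ _ hx hy => rw [map_mul, Module.End.mul_apply, hx, hy, mul_assoc]

include H in
/-- An algebra generated by a family with the Hecke–Clifford relations is semisimple if its generators
act on odd functions by `tOp` and `cOp` and the form on odd functions is anisotropic: it is then a
quotient of the semisimple module of odd functions. -/
theorem isSemisimpleRing_of_pairing_anisotropic (he : σ e = e)
    (hσ : ∀ f, pairing n σ f f = 0 → f = 0) : IsSemisimpleRing R := by
  let : Module R (OddFun n K) := Module.compHom _ α.toRingHom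
  have hsmul : ∀ (x : R) (f : OddFun n K), x • f = α x f := fun _ _ => rfl
  have : IsScalarTower K R (OddFun n K) := ⟨fun a x f => by
    rw [hsmul, hsmul, map_smul, LinearMap.smul_apply]⟩
  have hss : IsSemisimpleModule R (OddFun n K) := by
    refine isSemisimpleModule_of_anisotropic (pairing n σ) hσ hgen ?_
    rintro _ (⟨k, rfl⟩ | ⟨k, rfl⟩)
    · refine ⟨T k - e • (C (lo k) * C (hi k)), fun f h => ?_⟩
      have hadj : α (T k - e • (C (lo k) * C (hi k))) = tOpAdj e k := by
        rw [map_sub, map_smul, map_mul, hT, hC, hC, tOp, tOpAdj]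
        have h2 : e = e / 2 + e / 2 := (add_halves _).symm
        generalize e / 2 = d at h2 ⊢
        rw [h2]
        module
      rw [hsmul, hsmul, hadj, hT]
      exact isAdj_tOpAdj he k f h
    · refine ⟨-C k, fun f h => ?_⟩
      rw [hsmul, hsmul, map_neg, hC, LinearMap.neg_apply, map_neg, LinearMap.neg_apply,
        isAdj_cOp k f h, LinearMap.neg_apply, map_neg, neg_neg]
  let Φ : OddFun n K →ₗ[R] R :=
    { toFun := toAlg H
      map_add' := map_add _
      map_smul' := fun x f => toAlg_action H hgen hT hC x f }
  refine IsSemisimpleModule.of_surjective Φ fun x => ?_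
  obtain ⟨f, hf⟩ := toAlg_exists_eq_two H
  refine ⟨x • (2 : K)⁻¹ • f, ?_⟩
  rw [map_smul]
  change x • toAlg H ((2 : K)⁻¹ • f) = x
  have h2 : (2 : R) = (2 : K) • 1 := by
    rw [two_smul, one_add_one_eq_two]
  rw [map_smul, hf, h2, inv_smul_smul₀ two_ne_zero, smul_eq_mul, mul_one]

end
end family

/-! ### The presented algebra -/

section presented
variable (q : Kˣ)

variable (n) in
/-- The projection from the free algebra. -/
noncomputable def presentation :
    FreeAlgebra K (HeckeCliffordGen n) →ₐ[K] HeckeCliffordAlgebra K q n :=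
  RingQuot.mkAlgHom K (Rel K q n)

variable (n) in
theorem isHeckeCliffordFamily_presentation :
    IsHeckeCliffordFamily ((q : K) - ((q⁻¹ : Kˣ) : K)) (fun k => presentation n q (freeT K k))
      (fun k => presentation n q (freeC K k)) := by
  have hrel : ∀ {x y}, Rel K q n x y → presentation n q x = presentation n q y :=
    fun h => RingQuot.mkAlgHom_rel K h
  constructor
  · intro k
    have h := hrel (.quadratic k)
    rw [map_mul, map_sub, map_add, map_zero, AlgHom.commutes, AlgHom.commutes,
      Algebra.algebraMap_eq_smul_one, Algebra.algebraMap_eq_smul_one, mul_add, sub_mul, sub_mul,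
      smul_one_mul, mul_smul_one, smul_one_mul, smul_smul, Units.mul_inv, one_smul] at h
    rw [← sub_eq_zero, ← h]
    module
  · intro k l h
    rw [← map_mul, ← map_mul, ← map_mul, ← map_mul]
    exact hrel (.braid k l h)
  · intro k l h
    rw [← map_mul, ← map_mul]
    exact hrel (.comm k l h)
  · intro k
    have h := hrel (.square k)
    rwa [sq, map_mul, map_neg, map_one] at h
  · intro k l h
    have h := hrel (.anticomm k l h.symm)
    rwa [map_mul, map_neg, map_mul] at h
  · intro k
    rw [← map_mul, ← map_mul]
    exact hrel (.crossLo k)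
  · intro k
    have h := hrel (.crossHi k)
    rwa [map_sub, map_mul, map_mul, map_smul, map_sub] at h
  · intro k l h₁ h₂
    rw [← map_mul, ← map_mul]
    exact hrel (.crossComm k l h₁ h₂)

theorem adjoin_generators : Algebra.adjoin K
    (Set.range (fun k => presentation n q (freeT K k)) ∪
      Set.range (fun k => presentation n q (freeC K k))) = ⊤ := by
  have hs : Function.Surjective (presentation n q) := RingQuot.mkAlgHom_surjective K _
  rw [← (AlgHom.range_eq_top _).2 hs, ← Algebra.map_top, ← FreeAlgebra.adjoin_range_ι,
    AlgHom.map_adjoin]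
  congr 1
  ext x
  constructor
  · rintro (⟨k, rfl⟩ | ⟨k, rfl⟩)
    · exact ⟨_, ⟨HeckeCliffordGen.T k, rfl⟩, rfl⟩
    · exact ⟨_, ⟨HeckeCliffordGen.C k, rfl⟩, rfl⟩
  · rintro ⟨_, ⟨k | k, rfl⟩, rfl⟩
    · exact Or.inl ⟨k, rfl⟩
    · exact Or.inr ⟨k, rfl⟩

/-- The universal property of the presented algebra. -/
theorem exists_algHom_of_family {R : Type*} [Ring R] [Algebra K R]
    {T : Fin (n - 1) → R} {C : Fin n → R}
    (H : IsHeckeCliffordFamily ((q : K) - ((q⁻¹ : Kˣ) : K)) T C) :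
    ∃ α : HeckeCliffordAlgebra K q n →ₐ[K] R, (∀ k, α (presentation n q (freeT K k)) = T k) ∧
      ∀ k, α (presentation n q (freeC K k)) = C k := by
  let φ : FreeAlgebra K (HeckeCliffordGen n) →ₐ[K] R := FreeAlgebra.lift K fun x => match x with
    | .T k => T k
    | .C k => C k
  have hφT : ∀ k, φ (freeT K k) = T k := fun k => FreeAlgebra.lift_ι_apply _ _
  have hφC : ∀ k, φ (freeC K k) = C k := fun k => FreeAlgebra.lift_ι_apply _ _
  have hφ : ∀ ⦃x y⦄, Rel K q n x y → φ x = φ y := by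
    intro x y h
    cases h with
    | quadratic k =>
      have h := H.quadratic k
      rw [map_mul, map_sub, map_add, map_zero, AlgHom.commutes, AlgHom.commutes, hφT,
        Algebra.algebraMap_eq_smul_one, Algebra.algebraMap_eq_smul_one, mul_add, sub_mul, sub_mul,
        smul_one_mul, mul_smul_one, smul_one_mul, smul_smul, Units.mul_inv, one_smul, h]
      module
    | braid k l h => simpa only [map_mul, hφT] using H.braid k l h
    | comm k l h => simpa only [map_mul, hφT] using H.comm k l h
    | square k => simpa only [sq, map_mul, map_neg, map_one, hφC] using H.square k
    | anticomm k l h => simpa only [map_mul, map_neg, hφC] using H.anticomm k l h.symm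
    | crossLo k => simpa only [map_mul, hφT, hφC] using H.crossLo k
    | crossHi k => simpa only [map_mul, map_sub, map_smul, hφT, hφC] using H.crossHi k
    | crossComm k l h₁ h₂ => simpa only [map_mul, hφT, hφC] using H.crossComm k l h₁ h₂
  refine ⟨RingQuot.liftAlgHom K ⟨φ, hφ⟩, fun k => ?_, fun k => ?_⟩
  · exact (RingQuot.liftAlgHom_mkAlgHom_apply K φ hφ _).trans (hφT k)
  · exact (RingQuot.liftAlgHom_mkAlgHom_apply K φ hφ _).trans (hφC k)

end presented

end HeckeClifford

theorem proposition2p2 (n : ℕ) (hn : 1 ≤ n) :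
    IsSemisimpleRing (HeckeCliffordAlgebra (RatFunc ℂ) qUnit n) := by
  have he : ratFuncConj ((qUnit : RatFunc ℂ) - ((qUnit⁻¹ : (RatFunc ℂ)ˣ) : RatFunc ℂ))
      = (qUnit : RatFunc ℂ) - ((qUnit⁻¹ : (RatFunc ℂ)ˣ) : RatFunc ℂ) := by
    rw [map_sub, Units.val_inv_eq_inv_val, map_inv₀]
    simp only [qUnit, Units.val_mk0, ratFuncConj_X]
  have hσ : ∀ f, HeckeClifford.pairing n ratFuncConj f f = 0 → f = 0 := fun f hf => by
    ext g u
    exact eq_zero_of_sum_ratFuncConj_mul_self Finset.univ (fun p => f p) hf (g, u)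
      (Finset.mem_univ _)
  obtain ⟨α, hT, hC⟩ := HeckeClifford.exists_algHom_of_family qUnit
    (HeckeClifford.isHeckeCliffordFamily_op he hσ)
  exact HeckeClifford.isSemisimpleRing_of_pairing_anisotropic
    (HeckeClifford.isHeckeCliffordFamily_presentation n qUnit)
    (HeckeClifford.adjoin_generators qUnit) hT hC he hσ
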